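/- All graphs are finite and simple. A tree decomposition of a graph $G$ consists of a tree $T$ and a (nonempty) subtree $S_v$ of $T$ for each vertex $v$ of $G$ such that $V(S_u)\cap V(S_v)\neq\emptyset$ whenever $uv\in E(G)$; its width is the maximum over the nodes $t$ of $T$ of $|\{v : t\in V(S_v)\}|-1$. The treewidth of $G$ is the minimum width of a tree decomposition of $G$. For a graph $H$, let $f(H)$ be the minimum integer $k$ such that every graph that does not contain $H$ as a minor has treewidth at most $k$, with $f(H)=\infty$ if there is no such integer. (Here $H$ is a minor of $G$ if there are pairwise disjoint nonempty sets $B_w\subseteq V(G)$, one for each $w\in V(H)$, each inducing a connected subgraph of $G$, such that $G$ has an edge between $B_u$ and $B_w$ whenever $uw\in E(H)$.) Proposition. For every real $c>0$ there is a real $d>0$ such that, for every graph $H$ with at least two vertices, if $f(H)\le c\,|V(H)|$, then $H$ contains at most $\dfrac{d\,|V(H)|}{\log |V(H)|}$ pairwise vertex-disjoint cycles. -/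

import Mathlib

open scoped ENNReal

namespace SimpleGraph

/-- A tree decomposition of `G`: a finite tree `tree` and a subtree of it for each vertex of `G`,
such that the subtrees of adjacent vertices share a node. (The subtrees are given as nonempty
connected subgraphs of the tree, which are the same thing.) -/
structure TreeDecomposition {V : Type*} (G : SimpleGraph V) where
  Node : Type
  finite_node : Finite Node
  tree : SimpleGraph Node
  isTree : tree.IsTree
  subtree : V → tree.Subgraph
  subtree_connected : ∀ v, (subtree v).Connected
  inter_nonempty : ∀ u v, G.Adj u v → ((subtree u).verts ∩ (subtree v).verts).Nonempty

/-- The bag of a node `t`: the vertices whose subtree contains `t`. -/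
def TreeDecomposition.bag {V : Type*} {G : SimpleGraph V} (D : G.TreeDecomposition)
    (t : D.Node) : Set V :=
  {v | t ∈ (D.subtree v).verts}

/-- The width of a tree decomposition: the maximum of `|bag t| - 1` over the nodes `t`.
(An empty bag contributes `0`, so the graph without vertices gets treewidth `0`.) -/
noncomputable def TreeDecomposition.width {V : Type*} {G : SimpleGraph V}
    (D : G.TreeDecomposition) : ℕ∞ :=
  ⨆ t : D.Node, ((D.bag t).encard - 1)

/-- The treewidth of a (finite) graph: the minimum width of its tree decompositions. -/
noncomputable def treewidth {V : Type*} (G : SimpleGraph V) : ℕ∞ :=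
  ⨅ D : G.TreeDecomposition, D.width

/-- `H` is (isomorphic to) a minor of `G`: there are pairwise disjoint nonempty connected branch
sets in `G`, one for each vertex of `H`, with an edge of `G` between the branch sets of any two
adjacent vertices of `H`. -/
def IsMinor {W V : Type*} (H : SimpleGraph W) (G : SimpleGraph V) : Prop :=
  ∃ B : W → Set V,
    (∀ w, (G.induce (B w)).Connected) ∧
    (∀ u w, u ≠ w → Disjoint (B u) (B w)) ∧
    (∀ u w, H.Adj u w → ∃ x ∈ B u, ∃ y ∈ B w, G.Adj x y)

/-- The function `f(H)`: the least `k` such that every finite graph that does not contain `H` as a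
minor has treewidth at most `k`, and `⊤` if there is no such integer. Finite graphs are taken up
to isomorphism, on the vertex sets `Fin n`. -/
noncomputable def minorTreewidthBound {W : Type*} (H : SimpleGraph W) : ℕ∞ :=
  sInf {k : ℕ∞ | ∀ (n : ℕ) (G : SimpleGraph (Fin n)), ¬ H.IsMinor G → G.treewidth ≤ k}

/-- `H` contains `k` (pairwise) vertex-disjoint cycles. -/
def HasDisjointCycles {W : Type*} (H : SimpleGraph W) (k : ℕ) : Prop :=
  ∃ (v : Fin k → W) (C : ∀ i, H.Walk (v i) (v i)),
    (∀ i, (C i).IsCycle) ∧ ∀ i j, i ≠ j → (C i).support.Disjoint (C j).support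

end SimpleGraph

/-!
If `f(H) ≤ c |V(H)|`, then `H` is a minor of every graph of treewidth larger than `c |V(H)|`, and
disjoint cycles of a minor lift to disjoint cycles of the graph. So it suffices to find a graph on
`N = O(|V(H)|)` vertices that has treewidth at least `N / 42` but only `O(N / log N)` disjoint
cycles. The random graph on `N = 42 q` vertices with edge probability `1 / q` works.

* There are at most `4 ^ (42 q)` pairs of disjoint vertex sets of size at least `10 q`, and each has
  no edge between its sides with probability at most `(1 - 1 / q) ^ (100 q²) ≤ e ^ (-100 q)`. So
  with probability more than one half there is no such pair with no edge between its sides. A tree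
  decomposition of width less than `q` would produce one: take the bag at a weighted median `t` of
  the tree as a separator and group the branches of the tree at `t`, each of which carries at most
  half of the vertices.
* The expected number of labelled cycles of length `n` is at most `N ^ n / q ^ n = 42 ^ n`. So some
  choice of the graph also has `O(√N)` cycles of length at most `L = ½ log₄₂ N`, while each longer
  cycle uses up more than `L` vertices.
-/

namespace DisjointCycles

open SimpleGraph Finset

section MinorModel

variable {V W : Type*} {G : SimpleGraph V} {H : SimpleGraph W} {B : W → Set V}

/-- A minor model of `H` in `G`: the sets `B w` are the branch sets witnessing that `H` is a minor
of `G`, so that `H.IsMinor G` says that some `B` is a minor model. -/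
structure IsMinorModel (H : SimpleGraph W) (G : SimpleGraph V) (B : W → Set V) : Prop where
  connected : ∀ w, (G.induce (B w)).Connected
  disjoint : Pairwise fun u w => Disjoint (B u) (B w)
  exists_adj : ∀ u w, H.Adj u w → ∃ x ∈ B u, ∃ y ∈ B w, G.Adj x y

namespace IsMinorModel

lemma eq_of_mem (hB : IsMinorModel H G B) {u w : W} {x : V} (hu : x ∈ B u) (hw : x ∈ B w) :
    u = w :=
  hB.disjoint.eq (Set.not_disjoint_iff.2 ⟨x, hu, hw⟩)

lemma reachable_of_mem (hB : IsMinorModel H G B) {w : W} {x y : V} (hx : x ∈ B w)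
    (hy : y ∈ B w) : G.Reachable x y :=
  ((hB.connected w).preconnected ⟨x, hx⟩ ⟨y, hy⟩).map (Embedding.induce (B w)).toHom

lemma reachable (hB : IsMinorModel H G B) {u w : W} (huw : H.Reachable u w) {x y : V}
    (hx : x ∈ B u) (hy : y ∈ B w) : G.Reachable x y := by
  obtain ⟨p⟩ := huw
  induction p generalizing x with
  | nil => exact hB.reachable_of_mem hx hy
  | cons h _ ih =>
    obtain ⟨x', hx', y', hy', hadj⟩ := hB.exists_adj _ _ h
    exact (hB.reachable_of_mem hx hx').trans (hadj.reachable.trans (ih hy' hy))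

lemma deleteEdge (hB : IsMinorModel H G B) {u w : W} {a b : V} (hne : u ≠ w) (ha : a ∈ B u)
    (hb : b ∈ B w) :
    IsMinorModel (H.deleteEdges {s(u, w)}) (G.deleteEdges {s(a, b)}) B := by
  have eq_of_eq {x y : W} {s t : V} (hs : s ∈ B x) (ht : t ∈ B y) (h : s(s, t) = s(a, b)) :
      s(x, y) = s(u, w) := by
    rcases Sym2.eq_iff.1 h with ⟨rfl, rfl⟩ | ⟨rfl, rfl⟩
    · rw [hB.eq_of_mem hs ha, hB.eq_of_mem ht hb]
    · rw [hB.eq_of_mem hs hb, hB.eq_of_mem ht ha, Sym2.eq_swap]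
  refine ⟨fun x => ?_, hB.disjoint, fun x y hxy => ?_⟩
  · have induce_eq : (G.deleteEdges {s(a, b)}).induce (B x) = G.induce (B x) := by
      ext s t
      simp only [comap_adj, deleteEdges_adj, Set.mem_singleton_iff, and_iff_left_iff_imp]
      intro _ hst
      have hxx := eq_of_eq s.2 t.2 hst
      exact hne (Sym2.mk_isDiag_iff.1 (hxx ▸ Sym2.mk_isDiag_iff.2 rfl))
    exact induce_eq ▸ hB.connected x
  · rw [deleteEdges_adj] at hxy
    obtain ⟨s, hs, t, ht, hst⟩ := hB.exists_adj x y hxy.1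
    exact ⟨s, hs, t, ht, deleteEdges_adj.2 ⟨hst, fun h => hxy.2 (eq_of_eq hs ht h)⟩⟩

lemma isAcyclic (hB : IsMinorModel H G B) (hG : G.IsAcyclic) : H.IsAcyclic := by
  rw [isAcyclic_iff_forall_adj_isBridge] at hG ⊢
  intro u w huw
  obtain ⟨a, ha, b, hb, hab⟩ := hB.exists_adj u w huw
  exact isBridge_iff.2 fun h =>
    isBridge_iff.1 (hG hab) ((hB.deleteEdge huw.ne ha hb).reachable h ha hb)

lemma induce (hB : IsMinorModel H G B) (S : Set W) :
    IsMinorModel (H.induce S) (G.induce (⋃ w ∈ S, B w)) fun w => Subtype.val ⁻¹' B w where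
  connected w := by
    have subset : B w ⊆ ⋃ w ∈ S, B w := Set.subset_biUnion_of_mem w.2
    let inclusion : G.induce (B w) →g (G.induce (⋃ w ∈ S, B w)).induce (Subtype.val ⁻¹' B w) :=
      ⟨fun x => ⟨⟨x, subset x.2⟩, x.2⟩, fun h => h⟩
    exact (hB.connected w).map inclusion fun x => ⟨⟨x.1.1, x.2⟩, rfl⟩
  disjoint u w huw := (hB.disjoint (Subtype.coe_injective.ne huw)).preimage _
  exists_adj u w huw := by
    obtain ⟨x, hx, y, hy, hxy⟩ := hB.exists_adj u w huw
    exact ⟨⟨x, Set.mem_biUnion u.2 hx⟩, hx, ⟨y, Set.mem_biUnion w.2 hy⟩, hy, hxy⟩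

lemma exists_isCycle (hB : IsMinorModel H G B) {w : W} {p : H.Walk w w} (hp : p.IsCycle) :
    ∃ (v : V) (C : G.Walk v v), C.IsCycle ∧ ∀ x ∈ C.support, ∃ u ∈ p.support, x ∈ B u := by
  set S : Set W := {u | u ∈ p.support}
  have not_isAcyclic : ¬ (G.induce (⋃ u ∈ S, B u)).IsAcyclic := fun h =>
    (hB.induce S).isAcyclic h (p.induce S fun _ hu => hu) <|
      Walk.IsCycle.of_map (f := (Embedding.induce S).toHom) (by rwa [Walk.map_induce])
  simp only [IsAcyclic, not_forall, not_not] at not_isAcyclic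
  obtain ⟨v, C, hC⟩ := not_isAcyclic
  refine ⟨_, C.map (Embedding.induce _).toHom, hC.map Subtype.val_injective,
    fun x hx => ?_⟩
  rw [Walk.support_map, List.mem_map] at hx
  obtain ⟨x, -, rfl⟩ := hx
  simpa only [Set.mem_iUnion₂, exists_prop] using! x.2

end IsMinorModel

lemma hasDisjointCycles_of_isMinor (hHG : H.IsMinor G) {k : ℕ} (hk : H.HasDisjointCycles k) :
    G.HasDisjointCycles k := by
  obtain ⟨B, hconn, hdisj, hadj⟩ := hHG
  have hB : IsMinorModel H G B := ⟨hconn, fun u w => hdisj u w, hadj⟩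
  obtain ⟨v, C, hC, hCdisj⟩ := hk
  choose v' C' hC' hsupp using fun i => hB.exists_isCycle (hC i)
  refine ⟨v', C', hC', fun i j hij x hxi hxj => ?_⟩
  obtain ⟨u, hu, hxu⟩ := hsupp i x hxi
  obtain ⟨w, hw, hxw⟩ := hsupp j x hxj
  exact hCdisj i j hij hu (hB.eq_of_mem hxu hxw ▸ hw)

end MinorModel

section Centroid

variable {N : Type*} {T : SimpleGraph N}

lemma not_reachable_deleteIncidenceSet {t x : N} (h : x ≠ t) :
    ¬ (T.deleteIncidenceSet t).Reachable x t := by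
  rintro ⟨p⟩
  cases hp : p.reverse with
  | nil => exact h rfl
  | cons hadj _ => exact (deleteIncidenceSet_adj.1 hadj).2.1 rfl

lemma notMem_support_of_deleteIncidenceSet {t u x : N}
    (p : (T.deleteIncidenceSet t).Walk u x) (hu : u ≠ t) : t ∉ p.support := by
  classical
  exact fun ht => not_reachable_deleteIncidenceSet hu ⟨p.takeUntil t ht⟩

lemma exists_adj_reachable_deleteIncidenceSet (hT : T.Connected) {t x : N} (h : x ≠ t) :
    ∃ u, T.Adj t u ∧ (T.deleteIncidenceSet t).Reachable u x := by
  obtain ⟨p, hp⟩ := hT.exists_isPath t x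
  cases p with
  | nil => exact absurd rfl h
  | cons hadj p =>
    rw [Walk.cons_isPath_iff] at hp
    refine ⟨_, hadj, ⟨p.transfer _ fun e he => ?_⟩⟩
    rw [edgeSet_deleteIncidenceSet]
    exact ⟨p.edges_subset_edgeSet he, fun h => hp.2 (p.mem_support_of_mem_edges he h.2)⟩

lemma length_eq_dist_of_isPath (hT : T.IsAcyclic) {u v : N} {p : T.Walk u v} (hp : p.IsPath) :
    p.length = T.dist u v := by
  obtain ⟨q, hq, hlength⟩ := p.reachable.exists_path_of_dist
  have := hT.subsingleton_path u v
  have hpq : p = q := congrArg Subtype.val (Subsingleton.elim (⟨p, hp⟩ : T.Path u v) ⟨q, hq⟩)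
  rw [hpq, hlength]

lemma dist_eq_dist_add_one_of_reachable_deleteIncidenceSet (hT : T.IsAcyclic) {t u x : N}
    (htu : T.Adj t u) (hux : (T.deleteIncidenceSet t).Reachable u x) :
    T.dist t x = T.dist u x + 1 := by
  obtain ⟨p, hp⟩ := hux.exists_isPath
  have hq : (p.mapLe (deleteIncidenceSet_le T t)).IsPath := hp.mapLe _
  have ht : t ∉ (p.mapLe (deleteIncidenceSet_le T t)).support := by
    simpa using notMem_support_of_deleteIncidenceSet p htu.ne'
  rw [← length_eq_dist_of_isPath hT hq, ← length_eq_dist_of_isPath hT (hq.cons (h := htu) ht),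
    Walk.length_cons]

/-- A weighted median is a centroid: stepping from `t` into a branch brings that branch closer by
one and moves everything else away by at most one. -/
lemma exists_two_mul_card_reachable_deleteIncidenceSet_le {V : Type*} [Fintype V] (hT : T.IsTree)
    (f : V → N) :
    ∃ t, ∀ u, T.Adj t u →
      2 * Nat.card {v // (T.deleteIncidenceSet t).Reachable u (f v)} ≤ Fintype.card V := by
  classical
  have := hT.connected.nonempty
  let cost t := ∑ v, T.dist t (f v)
  obtain ⟨t, ht⟩ : ∃ t, ∀ u, cost t ≤ cost u :=
    ⟨Function.argmin cost, fun u => Function.argmin_le cost u⟩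
  refine ⟨t, fun u htu => ?_⟩
  have dist_add_le (v : V) :
      T.dist u (f v) + (if (T.deleteIncidenceSet t).Reachable u (f v) then 2 else 0) ≤
        T.dist t (f v) + 1 := by
    split_ifs with h
    · rw [dist_eq_dist_add_one_of_reachable_deleteIncidenceSet hT.isAcyclic htu h]
    · have := hT.connected.dist_triangle (u := u) (v := t) (w := f v)
      rw [dist_eq_one_iff_adj.2 htu.symm] at this
      omega
  have cost_add_le := sum_le_sum fun v (_ : v ∈ univ) => dist_add_le v
  rw [sum_add_distrib, sum_add_distrib, ← sum_filter, sum_const, sum_const, card_univ,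
    smul_eq_mul, smul_eq_mul] at cost_add_le
  have cost_le : ∑ v, T.dist t (f v) ≤ ∑ v, T.dist u (f v) := ht u
  rw [Nat.card_eq_fintype_card, Fintype.card_subtype]
  omega

end Centroid

section BalancedSeparator

lemma exists_balanced_fibres {V K : Type*} [Finite K] [DecidableEq K] {X : Finset V} {f : V → K}
    {a b m : ℕ} (hfibre : ∀ κ, #{x ∈ X | f x = κ} ≤ m) (hX : a + b + m ≤ #X) :
    ∃ S : Finset K, a ≤ #{x ∈ X | f x ∈ S} ∧ b ≤ #{x ∈ X | f x ∉ S} := by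
  classical
  cases nonempty_fintype K
  obtain ⟨S, hS⟩ := (Set.toFinite {S : Finset K | a ≤ #{x ∈ X | f x ∈ S}}).exists_minimal
    ⟨univ, by simpa using by omega⟩
  refine ⟨S, hS.prop, ?_⟩
  have card_split := card_filter_add_card_filter_not (s := X) (f · ∈ S)
  suffices #{x ∈ X | f x ∈ S} ≤ a + m by omega
  rcases S.eq_empty_or_nonempty with rfl | ⟨κ, hκ⟩
  · simp
  have erase_lt : #{x ∈ X | f x ∈ S.erase κ} < a := by
    by_contra! h
    exact notMem_erase κ S (hS.le_of_le h (erase_subset _ _) hκ)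
  calc #{x ∈ X | f x ∈ S} ≤ #({x ∈ X | f x ∈ S.erase κ} ∪ {x ∈ X | f x = κ}) :=
        card_le_card fun x hx => by simp only [mem_union, mem_filter, mem_erase] at hx ⊢; tauto
    _ ≤ a + m := (card_union_le _ _).trans (add_le_add erase_lt.le (hfibre κ))

variable {V : Type*} {G : SimpleGraph V}

/-- A bipartite hole of `G`: two disjoint vertex sets with no edge of `G` between them. -/
def IsBipartiteHole (G : SimpleGraph V) (A B : Finset V) : Prop :=
  Disjoint A B ∧ ∀ a ∈ A, ∀ b ∈ B, ¬ G.Adj a b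

lemma reachable_deleteIncidenceSet_of_mem_subtree (D : G.TreeDecomposition) {t : D.Node} {v : V}
    (hv : v ∉ D.bag t) {x y : D.Node} (hx : x ∈ (D.subtree v).verts)
    (hy : y ∈ (D.subtree v).verts) : (D.tree.deleteIncidenceSet t).Reachable x y := by
  let inclusion : (D.subtree v).coe →g D.tree.deleteIncidenceSet t :=
    ⟨Subtype.val, fun {a b} hab => deleteIncidenceSet_adj.2
      ⟨(D.subtree v).adj_sub hab, fun h => hv (h ▸ a.2), fun h => hv (h ▸ b.2)⟩⟩
  exact ((D.subtree_connected v).coe.preconnected ⟨x, hx⟩ ⟨y, hy⟩).map inclusion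

lemma exists_isBipartiteHole [Fintype V] (D : G.TreeDecomposition) {a b w : ℕ}
    (hbag : ∀ t, (D.bag t).ncard ≤ w) (hcard : 2 * (a + b + w) ≤ Fintype.card V) :
    ∃ A B, IsBipartiteHole G A B ∧ a ≤ #A ∧ b ≤ #B := by
  classical
  have := D.finite_node
  choose f hf using fun v => (D.subtree_connected v).nonempty
  obtain ⟨t, ht⟩ := exists_two_mul_card_reachable_deleteIncidenceSet_le D.isTree f
  let branch v := (D.tree.deleteIncidenceSet t).connectedComponentMk (f v)
  let X : Finset V := {v | v ∉ D.bag t}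
  have branch_eq {u v : V} (hu : u ∈ X) (hv : v ∈ X) (huv : G.Adj u v) : branch u = branch v := by
    obtain ⟨x, hxu, hxv⟩ := D.inter_nonempty u v huv
    exact ConnectedComponent.eq.2 <|
      (reachable_deleteIncidenceSet_of_mem_subtree D (mem_filter.1 hu).2 (hf u) hxu).trans
        (reachable_deleteIncidenceSet_of_mem_subtree D (mem_filter.1 hv).2 hxv (hf v))
  have card_branch (κ) : #{v ∈ X | branch v = κ} ≤ Fintype.card V / 2 := by
    rcases eq_empty_or_nonempty {v ∈ X | branch v = κ} with hempty | ⟨v, hv⟩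
    · simp [hempty]
    obtain ⟨hvX, rfl⟩ := mem_filter.1 hv
    have hvt : f v ≠ t := fun h => (mem_filter.1 hvX).2 (h ▸ hf v)
    obtain ⟨u, htu, hu⟩ := exists_adj_reachable_deleteIncidenceSet D.isTree.connected hvt
    rw [Nat.le_div_iff_mul_le two_pos, mul_comm]
    refine le_trans (Nat.mul_le_mul_left 2 ?_) (ht u htu)
    rw [Nat.card_eq_fintype_card, Fintype.card_subtype]
    exact card_le_card fun x hx => mem_filter.2
      ⟨mem_univ x, hu.trans (ConnectedComponent.eq.1 (mem_filter.1 hx).2).symm⟩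
  have card_bag : #{v | v ∈ D.bag t} ≤ w := by
    rw [← Set.ncard_coe_finset, coe_filter_univ]
    exact hbag t
  have card_split : #{v | v ∈ D.bag t} + #X = Fintype.card V := card_filter_add_card_filter_not _
  obtain ⟨S, ha, hb⟩ := exists_balanced_fibres card_branch (a := a) (b := b) (by omega)
  refine ⟨_, _, ⟨disjoint_filter_filter_not X X (branch · ∈ S), fun u hu v hv huv => ?_⟩, ha, hb⟩
  rw [mem_filter] at hu hv
  exact hv.2 (branch_eq hu.1 hv.1 huv ▸ hu.2)

lemma le_treewidth_of_forall_isBipartiteHole [Fintype V] {a b w : ℕ}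
    (hcard : 2 * (a + b + w) ≤ Fintype.card V)
    (hG : ∀ A B, IsBipartiteHole G A B → a ≤ #A → #B < b) : (w : ℕ∞) ≤ G.treewidth := by
  refine le_iInf fun D => ?_
  by_contra! hlt
  have hbag (t : D.Node) : (D.bag t).ncard ≤ w := by
    have h := (le_iSup (fun t => (D.bag t).encard - 1) t).trans_lt hlt
    rw [← (Set.toFinite (D.bag t)).cast_ncard_eq] at h
    have : (D.bag t).ncard - 1 < w := by exact_mod_cast h
    omega
  obtain ⟨A, B, hAB, ha, hb⟩ := exists_isBipartiteHole D hbag hcard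
  exact (hG A B hAB ha).not_ge hb

end BalancedSeparator

section ShortAndLongCycles

variable {V : Type*} {G : SimpleGraph V}

lemma labelledCopyCount_eq_natCard {W : Type*} [Fintype V] [Fintype W] (G : SimpleGraph V)
    (K : SimpleGraph W) : G.labelledCopyCount K = Nat.card (Copy K G) :=
  @Fintype.card_eq_nat_card _ _

lemma exists_copy_cycleGraph_of_isCycle {v : V} {C : G.Walk v v} (hC : C.IsCycle) :
    ∃ φ : Copy (cycleGraph C.length) G, ∀ i, φ i ∈ C.support := by
  let S : Set V := {x | x ∈ C.support}
  let C' := C.induce S fun _ hx => hx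
  have map_eq : C'.map (Embedding.induce S).toHom = C := C.map_induce _
  have hC' : C'.IsCycle := Walk.IsCycle.of_map (map_eq.symm ▸ hC)
  have length_eq : C'.length = C.length :=
    (Walk.length_map _ C').symm.trans (congrArg Walk.length map_eq)
  obtain ⟨φ⟩ := (cycleGraph_isContained_iff hC.three_le_length).2 ⟨_, C', hC', length_eq⟩
  exact ⟨(Embedding.induce S).toCopy.comp φ, fun i => (φ i).2⟩

variable [Fintype V] {ι : Type*} [Fintype ι] {v : ι → V} {C : ∀ i, G.Walk (v i) (v i)}

lemma card_length_eq_le_labelledCopyCount (hC : ∀ i, (C i).IsCycle)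
    (hdisj : ∀ i j, i ≠ j → (C i).support.Disjoint (C j).support) (n : ℕ) :
    #{i | (C i).length = n} ≤ G.labelledCopyCount (cycleGraph n) := by
  classical
  have exists_copy (i : {i // (C i).length = n}) :
      ∃ φ : Copy (cycleGraph n) G, ∀ j, φ j ∈ (C i).support := by
    obtain ⟨i, rfl⟩ := i
    exact exists_copy_cycleGraph_of_isCycle (hC i)
  choose φ hφ using exists_copy
  rw [labelledCopyCount_eq_natCard, ← Fintype.card_subtype, ← Nat.card_eq_fintype_card]
  refine Nat.card_le_card_of_injective φ fun i j hij => Subtype.ext ?_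
  by_contra hne
  have hn : 0 < n := by
    have := (hC i).three_le_length
    have := i.2
    omega
  exact hdisj i j hne (hφ i ⟨0, hn⟩) (hij ▸ hφ j ⟨0, hn⟩)

lemma mul_card_lt_length_le (hC : ∀ i, (C i).IsCycle)
    (hdisj : ∀ i j, i ≠ j → (C i).support.Disjoint (C j).support) (L : ℕ) :
    (L + 1) * #{i | L < (C i).length} ≤ Fintype.card V := by
  classical
  have tails_disjoint : (({i | L < (C i).length} : Finset ι) : Set ι).PairwiseDisjoint
      fun i => (C i).support.tail.toFinset := fun i _ j _ hij =>
    Finset.disjoint_left.2 fun x hxi hxj => hdisj i j hij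
      (List.mem_of_mem_tail (List.mem_toFinset.1 hxi))
      (List.mem_of_mem_tail (List.mem_toFinset.1 hxj))
  have card_tail (i : ι) : #(C i).support.tail.toFinset = (C i).length := by
    rw [List.toFinset_card_of_nodup (hC i).support_nodup, List.length_tail, Walk.length_support,
      Nat.add_sub_cancel]
  calc (L + 1) * #{i | L < (C i).length}
      = ∑ i with L < (C i).length, (L + 1) := by rw [sum_const, smul_eq_mul, mul_comm]
    _ ≤ ∑ i with L < (C i).length, #(C i).support.tail.toFinset :=
        sum_le_sum fun i hi => (mem_filter.1 hi).2.trans_eq (card_tail i).symm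
    _ ≤ Fintype.card V := by
        rw [← card_biUnion tails_disjoint]
        exact card_le_univ _

lemma mul_le_of_hasDisjointCycles {k : ℕ} (hk : G.HasDisjointCycles k) (L : ℕ) :
    (L + 1) * k ≤
      (L + 1) * ∑ n ∈ Icc 3 L, G.labelledCopyCount (cycleGraph n) + Fintype.card V := by
  obtain ⟨v, C, hC, hdisj⟩ := hk
  have card_short : #{i | (C i).length ≤ L} ≤
      ∑ n ∈ Icc 3 L, G.labelledCopyCount (cycleGraph n) := by
    rw [card_eq_sum_card_fiberwise (f := fun i => (C i).length) (t := Icc 3 L) fun i hi =>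
      mem_coe.2 (mem_Icc.2 ⟨(hC i).three_le_length, (mem_filter.1 hi).2⟩)]
    exact sum_le_sum fun n _ => (card_le_card (filter_subset_filter _ (filter_subset _ _))).trans
      (card_length_eq_le_labelledCopyCount hC hdisj n)
  have card_split : #{i | (C i).length ≤ L} + #{i | L < (C i).length} = k := by
    simpa only [not_le, card_fin] using
      card_filter_add_card_filter_not (s := univ) fun i => (C i).length ≤ L
  calc (L + 1) * k = (L + 1) * #{i | (C i).length ≤ L} + (L + 1) * #{i | L < (C i).length} := by
        rw [← mul_add, card_split]
    _ ≤ _ := add_le_add (Nat.mul_le_mul_left _ card_short) (mul_card_lt_length_le hC hdisj L)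

end ShortAndLongCycles

section RandomFunction

open scoped BigOperators

lemma dens_filter_forall_mem {ι Q : Type*} [Fintype ι] [DecidableEq ι] [Fintype Q] [DecidableEq Q]
    [Nonempty Q] (F : Finset ι) (P : Finset Q) :
    ({g : ι → Q | ∀ e ∈ F, g e ∈ P} : Finset (ι → Q)).dens = P.dens ^ #F := by
  have filter_eq_piFinset : ({g : ι → Q | ∀ e ∈ F, g e ∈ P} : Finset (ι → Q)) =
      Fintype.piFinset fun e => if e ∈ F then P else univ := by
    ext g
    simp only [mem_filter_univ, Fintype.mem_piFinset]
    exact forall_congr' fun e => by split_ifs with he <;> simp [he]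
  have dens_ite (e : ι) :
      (#(if e ∈ F then P else univ) : ℚ≥0) / Fintype.card Q = if e ∈ F then P.dens else 1 := by
    split_ifs
    · exact (dens_eq_card_div_card P).symm
    · rw [card_univ, div_self (Nat.cast_ne_zero.2 Fintype.card_ne_zero)]
  rw [filter_eq_piFinset, dens_eq_card_div_card, Fintype.card_piFinset, Fintype.card_fun,
    ← card_univ (α := ι), Nat.cast_pow, ← prod_const, Nat.cast_prod, ← prod_div_distrib,
    prod_congr rfl fun e _ => dens_ite e, prod_ite_mem, univ_inter, prod_const]

lemma expect_card_filter_forall_mem {ι Q τ : Type*} [Fintype ι] [DecidableEq ι] [Fintype Q]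
    [DecidableEq Q] [Nonempty Q] (I : Finset τ) (F : τ → Finset ι) (P : Finset Q) :
    𝔼 g : ι → Q, (#{t ∈ I | ∀ e ∈ F t, g e ∈ P} : ℝ) = ∑ t ∈ I, (P.dens : ℝ) ^ #(F t) := by
  simp_rw [card_filter, Nat.cast_sum, Nat.cast_ite, Nat.cast_one, Nat.cast_zero]
  rw [expect_sum_comm]
  refine sum_congr rfl fun t _ => ?_
  rw [← NNRat.cast_pow, ← dens_filter_forall_mem, nnratCast_dens, Fintype.expect_eq_sum_div_card,
    sum_boole]

end RandomFunction

section RandomGraph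

open scoped BigOperators

variable {V Q : Type*}

/-- The graph of the pairs to which `g` gives the colour `z`. For a uniformly random colouring `g`,
this is the binomial random graph whose edge probability is one over the number of colours. -/
def colourClass (g : Sym2 V → Q) (z : Q) : SimpleGraph V := fromEdgeSet (g ⁻¹' {z})

lemma colourClass_adj {g : Sym2 V → Q} {z : Q} {u v : V} :
    (colourClass g z).Adj u v ↔ g s(u, v) = z ∧ u ≠ v := fromEdgeSet_adj _

/-- The unordered pairs with one element in `A` and the other in `B`. -/
def pairsBetween [DecidableEq V] (A B : Finset V) : Finset (Sym2 V) :=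
  (A ×ˢ B).image fun p => s(p.1, p.2)

lemma card_pairsBetween [DecidableEq V] {A B : Finset V} (h : Disjoint A B) :
    #(pairsBetween A B) = #A * #B := by
  rw [pairsBetween, card_image_of_injOn, card_product]
  rintro ⟨a, b⟩ hab ⟨a', b'⟩ hab' he
  rw [mem_coe, mem_product] at hab hab'
  rcases Sym2.eq_iff.1 he with ⟨rfl, rfl⟩ | ⟨rfl, rfl⟩
  · rfl
  · exact absurd hab'.2 (disjoint_left.1 h hab.1)

lemma isBipartiteHole_colourClass_iff [DecidableEq V] {g : Sym2 V → Q} {z : Q}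
    {A B : Finset V} :
    IsBipartiteHole (colourClass g z) A B ↔ Disjoint A B ∧ ∀ e ∈ pairsBetween A B, g e ≠ z := by
  refine and_congr_right fun hAB => ?_
  simp only [pairsBetween, forall_mem_image, Prod.forall, mem_product, and_imp]
  refine ⟨fun h a b ha hb hz => h a ha b hb (colourClass_adj.2 ⟨hz, ?_⟩),
    fun h a ha b hb hab => h a b ha hb (colourClass_adj.1 hab).1⟩
  exact ne_of_mem_of_not_mem ha (disjoint_right.1 hAB hb)

variable [Fintype V]

open Classical in
/-- The bipartite holes of `G` whose two sides both have at least `s` vertices. -/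
noncomputable def bipartiteHoles (G : SimpleGraph V) (s : ℕ) : Finset (Finset V × Finset V) :=
  {p | IsBipartiteHole G p.1 p.2 ∧ s ≤ #p.1 ∧ s ≤ #p.2}

lemma mem_bipartiteHoles {G : SimpleGraph V} {s : ℕ} {p : Finset V × Finset V} :
    p ∈ bipartiteHoles G s ↔ IsBipartiteHole G p.1 p.2 ∧ s ≤ #p.1 ∧ s ≤ #p.2 := by
  classical
  exact mem_filter_univ p

variable [DecidableEq V] [Fintype Q]

lemma expect_card_bipartiteHoles_le (z : Q) (s : ℕ) :
    𝔼 g : Sym2 V → Q, (#(bipartiteHoles (colourClass g z) s) : ℝ) ≤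
      4 ^ Fintype.card V * (1 - 1 / Fintype.card Q) ^ s ^ 2 := by
  classical
  have : Nonempty Q := ⟨z⟩
  let I : Finset (Finset V × Finset V) := {p | Disjoint p.1 p.2 ∧ s ≤ #p.1 ∧ s ≤ #p.2}
  have bipartiteHoles_eq (g : Sym2 V → Q) : bipartiteHoles (colourClass g z) s =
      {p ∈ I | ∀ e ∈ pairsBetween p.1 p.2, g e ∈ ({z} : Finset Q)ᶜ} := by
    ext p
    simp only [mem_bipartiteHoles, I, isBipartiteHole_colourClass_iff, mem_filter, mem_univ,
      mem_compl, mem_singleton]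
    tauto
  have dens_compl : ((({z} : Finset Q)ᶜ.dens : ℚ≥0) : ℝ) = 1 - 1 / Fintype.card Q := by
    rw [nnratCast_dens, card_compl, card_singleton, Nat.cast_sub Fintype.card_pos, sub_div,
      Nat.cast_one, div_self (Nat.cast_ne_zero.2 Fintype.card_ne_zero)]
  have dens_nonneg : (0 : ℝ) ≤ 1 - 1 / Fintype.card Q := dens_compl ▸ NNRat.cast_nonneg _
  have card_I_le : #I ≤ 4 ^ Fintype.card V := by
    refine (card_le_univ I).trans_eq ?_
    rw [Fintype.card_prod, Fintype.card_finset, ← mul_pow]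
    norm_num
  simp_rw [bipartiteHoles_eq]
  rw [expect_card_filter_forall_mem, dens_compl]
  calc ∑ p ∈ I, (1 - 1 / (Fintype.card Q : ℝ)) ^ #(pairsBetween p.1 p.2)
      ≤ ∑ p ∈ I, (1 - 1 / (Fintype.card Q : ℝ)) ^ s ^ 2 := sum_le_sum fun p hp => by
        obtain ⟨-, hdisj, hs₁, hs₂⟩ := mem_filter.1 hp
        rw [card_pairsBetween hdisj, sq]
        exact pow_le_pow_of_le_one dens_nonneg (by simp) (Nat.mul_le_mul hs₁ hs₂)
    _ = #I * (1 - 1 / (Fintype.card Q : ℝ)) ^ s ^ 2 := by rw [sum_const, nsmul_eq_mul]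
    _ ≤ 4 ^ Fintype.card V * (1 - 1 / (Fintype.card Q : ℝ)) ^ s ^ 2 := by
        gcongr
        exact_mod_cast card_I_le

lemma expect_labelledCopyCount_colourClass_le {W : Type*} [Fintype W] (K : SimpleGraph W)
    [DecidableRel K.Adj] (z : Q) :
    𝔼 g : Sym2 V → Q, ((colourClass g z).labelledCopyCount K : ℝ) ≤
      (Fintype.card V : ℝ) ^ Fintype.card W / (Fintype.card Q : ℝ) ^ #K.edgeFinset := by
  classical
  have : Nonempty Q := ⟨z⟩
  let edges (t : W ↪ V) : Finset (Sym2 V) := K.edgeFinset.map t.sym2Map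
  have labelledCopyCount_le (g : Sym2 V → Q) : (colourClass g z).labelledCopyCount K ≤
      #{t : W ↪ V | ∀ e ∈ edges t, g e ∈ ({z} : Finset Q)} := by
    rw [labelledCopyCount_eq_natCard, ← Fintype.card_subtype, ← Nat.card_eq_fintype_card]
    refine Nat.card_le_card_of_injective (fun φ => ⟨φ.toEmbedding, ?_⟩) fun φ ψ h =>
      Copy.ext fun w => DFunLike.congr_fun (congrArg Subtype.val h) w
    simp only [edges, forall_mem_map, mem_singleton]
    refine Sym2.ind fun u w huw => ?_
    exact (colourClass_adj.1 (φ.toHom.map_adj (mem_edgeFinset.1 huw))).1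
  calc 𝔼 g : Sym2 V → Q, ((colourClass g z).labelledCopyCount K : ℝ)
      ≤ 𝔼 g : Sym2 V → Q, (#{t : W ↪ V | ∀ e ∈ edges t, g e ∈ ({z} : Finset Q)} : ℝ) :=
        expect_le_expect fun g _ => Nat.cast_le.2 (labelledCopyCount_le g)
    _ = Fintype.card (W ↪ V) / (Fintype.card Q : ℝ) ^ #K.edgeFinset := by
        simp only [expect_card_filter_forall_mem, edges, card_map, dens_singleton, sum_const,
          card_univ, nsmul_eq_mul, NNRat.cast_inv, NNRat.cast_natCast, inv_pow, div_eq_mul_inv]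
    _ ≤ (Fintype.card V : ℝ) ^ Fintype.card W / (Fintype.card Q : ℝ) ^ #K.edgeFinset := by
        gcongr
        rw [Fintype.card_embedding_eq]
        exact_mod_cast Nat.descFactorial_le_pow _ _

lemma card_edgeFinset_cycleGraph {n : ℕ} (hn : 3 ≤ n) : #(cycleGraph n).edgeFinset = n := by
  obtain ⟨n, rfl⟩ := Nat.exists_eq_add_of_le' hn
  have := (cycleGraph (n + 3)).sum_degrees_eq_twice_card_edges
  simp only [cycleGraph_degree_three_le, sum_const, card_univ, Fintype.card_fin, smul_eq_mul]
    at this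
  omega

lemma expect_labelledCopyCount_cycleGraph_le (z : Q) {n : ℕ} (hn : 3 ≤ n) :
    𝔼 g : Sym2 V → Q, ((colourClass g z).labelledCopyCount (cycleGraph n) : ℝ) ≤
      ((Fintype.card V : ℝ) / Fintype.card Q) ^ n := by
  refine (expect_labelledCopyCount_colourClass_le (cycleGraph n) z).trans_eq ?_
  rw [Fintype.card_fin, card_edgeFinset_cycleGraph hn, div_pow]

end RandomGraph

section SparseGraphOfLargeTreewidth

open scoped BigOperators

lemma four_pow_mul_one_sub_one_div_pow_lt_half {q : ℕ} (hq : 0 < q) :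
    (4 : ℝ) ^ (42 * q) * (1 - 1 / q) ^ (10 * q) ^ 2 < 1 / 2 := by
  have one_le_q : (1 : ℝ) ≤ q := by exact_mod_cast hq
  have four_le_exp : (4 : ℝ) ≤ Real.exp 2 := by
    have := Real.exp_one_gt_two
    rw [show (2 : ℝ) = 1 + 1 by norm_num, Real.exp_add]
    nlinarith
  have pow_le_exp : (1 - 1 / (q : ℝ)) ^ q ≤ Real.exp (-1) :=
    Real.one_sub_div_pow_le_exp_neg one_le_q
  have base_nonneg : 0 ≤ 1 - 1 / (q : ℝ) := sub_nonneg.2 ((div_le_one (by positivity)).2 one_le_q)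
  calc (4 : ℝ) ^ (42 * q) * (1 - 1 / q) ^ (10 * q) ^ 2
      = 4 ^ (42 * q) * ((1 - 1 / q) ^ q) ^ (100 * q) := by rw [← pow_mul]; ring_nf
    _ ≤ Real.exp 2 ^ (42 * q) * Real.exp (-1) ^ (100 * q) := by gcongr
    _ = Real.exp (-(16 * q)) := by
        rw [← Real.exp_nat_mul, ← Real.exp_nat_mul, ← Real.exp_add]
        push_cast
        ring_nf
    _ ≤ Real.exp (-1) := Real.exp_le_exp.2 (by linarith)
    _ < 1 / 2 := Real.exp_neg_one_lt_half

lemma exists_colourClass_few_short_cycles {V Q : Type*} [Fintype V] [Fintype Q]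
    (z : Q) (hV : Fintype.card V = 42 * Fintype.card Q) (L : ℕ) :
    ∃ g : Sym2 V → Q, bipartiteHoles (colourClass g z) (10 * Fintype.card Q) = ∅ ∧
      ∑ n ∈ Icc 3 L, (colourClass g z).labelledCopyCount (cycleGraph n) ≤ 2 * 42 ^ (L + 1) := by
  classical
  have : Nonempty Q := ⟨z⟩
  have card_pos : 0 < Fintype.card Q := Fintype.card_pos
  let holes (g : Sym2 V → Q) : ℕ := #(bipartiteHoles (colourClass g z) (10 * Fintype.card Q))
  let copies (g : Sym2 V → Q) : ℕ :=
    ∑ n ∈ Icc 3 L, (colourClass g z).labelledCopyCount (cycleGraph n)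
  let M : ℕ := 2 * 42 ^ (L + 1)
  have expect_holes_lt : 𝔼 g, (holes g : ℝ) < 1 / 2 :=
    (expect_card_bipartiteHoles_le z _).trans_lt <| by
      rw [hV]
      exact four_pow_mul_one_sub_one_div_pow_lt_half card_pos
  have expect_copies_le : 𝔼 g, (copies g : ℝ) ≤ M / 2 := by
    simp_rw [copies, Nat.cast_sum]
    rw [expect_sum_comm]
    calc ∑ n ∈ Icc 3 L, 𝔼 g, ((colourClass g z).labelledCopyCount (cycleGraph n) : ℝ)
        ≤ ∑ n ∈ Icc 3 L, (42 : ℝ) ^ n := sum_le_sum fun n hn => by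
          refine (expect_labelledCopyCount_cycleGraph_le z (mem_Icc.1 hn).1).trans_eq ?_
          rw [hV]
          push_cast
          rw [mul_div_cancel_right₀ _ (by positivity)]
      _ ≤ 42 ^ (L + 1) := by
          exact_mod_cast (Nat.geomSum_lt (by norm_num : 2 ≤ 42)
            fun n hn => Nat.lt_succ_of_le (mem_Icc.1 hn).2).le
      _ = M / 2 := by simp [M]
  have expect_lt : 𝔼 g, (M * holes g + copies g : ℝ) < M := by
    rw [expect_add_distrib, ← mul_expect]
    have : (0 : ℝ) < M := by positivity
    nlinarith
  obtain ⟨g, -, hg⟩ := exists_lt_of_expect_lt univ_nonempty expect_lt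
  have hg : M * holes g + copies g < M := by exact_mod_cast hg
  refine ⟨g, card_eq_zero.1 ?_, ((Nat.le_add_left _ _).trans_lt hg).le⟩
  by_contra h
  have : M ≤ M * holes g := Nat.le_mul_of_pos_right M (Nat.pos_of_ne_zero h)
  omega

lemma sqrt_mul_log_le {x : ℝ} (hx : 0 ≤ x) : √x * Real.log x ≤ 2 * x := by
  have h := mul_le_mul_of_nonneg_left (Real.log_le_self (Real.sqrt_nonneg x)) (Real.sqrt_nonneg x)
  rw [Real.log_sqrt hx, Real.mul_self_sqrt hx] at h
  linarith

lemma mul_log_le_of_mul_le {b N k L : ℕ} (hb : 1 < b) (hN : N ≠ 0) (hL : L = Nat.log (b ^ 2) N)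
    (hk : (L + 1) * k ≤ (L + 1) * (2 * b ^ (L + 1)) + N) :
    k * Real.log N ≤ 6 * b * N := by
  have pow_le_sqrt : (b : ℝ) ^ L ≤ √N := by
    refine Real.le_sqrt_of_sq_le ?_
    rw [pow_right_comm, hL]
    exact_mod_cast Nat.pow_log_le_self (b ^ 2) hN
  have log_le : Real.log N ≤ 2 * b * (L + 1) := by
    have lt_pow : (N : ℝ) < (b ^ 2) ^ (L + 1) := by
      rw [hL]
      exact_mod_cast Nat.lt_pow_succ_log_self (Nat.one_lt_pow two_ne_zero hb) N
    calc Real.log N ≤ Real.log ((b ^ 2) ^ (L + 1)) := Real.log_le_log (by positivity) lt_pow.le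
      _ = 2 * Real.log b * (L + 1) := by
          rw [Real.log_pow, Real.log_pow]
          push_cast
          ring
      _ ≤ 2 * b * (L + 1) := by
          gcongr
          exact Real.log_le_self b.cast_nonneg
  have k_le : (k : ℝ) ≤ 2 * b * √N + N / (L + 1) := by
    have hk : ((L : ℝ) + 1) * k ≤ (L + 1) * (2 * b ^ (L + 1)) + N := by exact_mod_cast hk
    calc (k : ℝ) ≤ 2 * b * b ^ L + N / (L + 1) := by
          rw [← mul_le_mul_iff_right₀ (show (0 : ℝ) < L + 1 by positivity), mul_add,
            mul_div_cancel₀ _ (by positivity), mul_assoc, ← pow_succ']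
          exact hk
      _ ≤ 2 * b * √N + N / (L + 1) := by gcongr
  calc k * Real.log N ≤ (2 * b * √N + N / (L + 1)) * Real.log N :=
        mul_le_mul_of_nonneg_right k_le (Real.log_natCast_nonneg N)
    _ = 2 * b * (√N * Real.log N) + N / (L + 1) * Real.log N := by ring
    _ ≤ 2 * b * (2 * N) + N / (L + 1) * (2 * b * (L + 1)) :=
        add_le_add (mul_le_mul_of_nonneg_left (sqrt_mul_log_le N.cast_nonneg) (by positivity))
          (mul_le_mul_of_nonneg_left log_le (by positivity))
    _ = 6 * b * N := by
        field_simp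
        ring

lemma exists_le_treewidth_and_forall_hasDisjointCycles {q : ℕ} (hq : 0 < q) :
    ∃ G : SimpleGraph (Fin (42 * q)), (q : ℕ∞) ≤ G.treewidth ∧
      ∀ k, G.HasDisjointCycles k → k * Real.log (42 * q : ℕ) ≤ 252 * (42 * q : ℕ) := by
  let L := Nat.log (42 ^ 2) (42 * q)
  obtain ⟨g, no_holes, few_copies⟩ := exists_colourClass_few_short_cycles (V := Fin (42 * q))
    (⟨0, hq⟩ : Fin q) (by simp only [Fintype.card_fin]) L
  rw [Fintype.card_fin] at no_holes
  refine ⟨colourClass g ⟨0, hq⟩, ?_, fun k hk => ?_⟩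
  · refine le_treewidth_of_forall_isBipartiteHole (a := 10 * q) (b := 10 * q)
      (by rw [Fintype.card_fin]; omega) fun A B hAB hA => ?_
    by_contra! hB
    have : (A, B) ∈ bipartiteHoles (colourClass g ⟨0, hq⟩) (10 * q) :=
      mem_bipartiteHoles.2 ⟨hAB, hA, hB⟩
    exact notMem_empty _ (no_holes ▸ this)
  · refine (mul_log_le_of_mul_le (b := 42) (L := L) (by norm_num) (by omega) rfl ?_).trans_eq
      (by norm_num)
    refine (mul_le_of_hasDisjointCycles hk L).trans ?_
    rw [Fintype.card_fin]
    gcongr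

end SparseGraphOfLargeTreewidth

lemma isMinor_of_minorTreewidthBound_lt {W : Type*} {H : SimpleGraph W} {n : ℕ}
    {G : SimpleGraph (Fin n)} (h : H.minorTreewidthBound < G.treewidth) : H.IsMinor G := by
  by_contra hminor
  exact h.not_ge (le_sInf fun k hk => hk n G hminor)

lemma minorTreewidthBound_lt_of_le_ofReal {W : Type*} {H : SimpleGraph W} {x : ℝ} {q : ℕ}
    (h : (H.minorTreewidthBound : ℝ≥0∞) ≤ ENNReal.ofReal x) (hq : 0 < q) (hx : x < q) :
    H.minorTreewidthBound < q := by
  rw [← ENat.toENNReal_lt, ENat.toENNReal_coe, ← ENNReal.ofReal_natCast]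
  exact h.trans_lt ((ENNReal.ofReal_lt_ofReal_iff (Nat.cast_pos.2 hq)).2 hx)

end DisjointCycles

theorem mainTheorem8 :
    ∀ c : ℝ, 0 < c → ∃ d : ℝ, 0 < d ∧
      ∀ (V : Type*) [Fintype V] (H : SimpleGraph V), 2 ≤ Fintype.card V →
        (H.minorTreewidthBound : ℝ≥0∞) ≤ ENNReal.ofReal (c * (Fintype.card V : ℝ)) →
        ∀ k : ℕ, H.HasDisjointCycles k →
          (k : ℝ) ≤ d * (Fintype.card V : ℝ) / Real.log (Fintype.card V : ℝ) := by
  intro c hc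
  refine ⟨252 * 42 * (c + 2), by positivity, fun V _ H hV hf k hk => ?_⟩
  set n := Fintype.card V
  have two_le_n : (2 : ℝ) ≤ n := by exact_mod_cast hV
  obtain ⟨q, lt_q, q_le⟩ : ∃ q : ℕ, (c + 1) * n < q ∧ (q : ℝ) ≤ (c + 2) * n :=
    ⟨⌊(c + 1) * n⌋₊ + 1, by exact_mod_cast Nat.lt_floor_add_one _, by
      push_cast
      linarith [Nat.floor_le (show 0 ≤ (c + 1) * (n : ℝ) by positivity)]⟩
  have q_pos : 0 < q := by exact_mod_cast (show (0 : ℝ) ≤ (c + 1) * n by positivity).trans_lt lt_q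
  have n_le : n ≤ 42 * q := by exact_mod_cast (by nlinarith : (n : ℝ) ≤ 42 * q)
  obtain ⟨G, le_treewidth, cycles_le⟩ :=
    DisjointCycles.exists_le_treewidth_and_forall_hasDisjointCycles q_pos
  have hminor : H.IsMinor G := DisjointCycles.isMinor_of_minorTreewidthBound_lt <|
    (DisjointCycles.minorTreewidthBound_lt_of_le_ofReal hf q_pos (by linarith)).trans_le
      le_treewidth
  rw [le_div_iff₀ (Real.log_pos (by linarith))]
  calc k * Real.log n ≤ k * Real.log (42 * q : ℕ) := by gcongr
    _ ≤ 252 * (42 * q : ℕ) :=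
        cycles_le k (DisjointCycles.hasDisjointCycles_of_isMinor hminor hk)
    _ ≤ 252 * 42 * (c + 2) * n := by
        push_cast
        linarith
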